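/- \textbf{Lemma (existence of a pure Nash equilibrium in the continuous non-cooperative network design game).} \emph{Network.} Let $\Gamma=(\mathcal V,\mathcal E)$, $\mathcal E\subseteq\mathcal V\times\mathcal V$ finite, be a directed graph whose vertices are partitioned into the regions of $N$ operators and, independently, into a public-transport (PT) layer and an alternative-mode layer. $\mathcal E_P$ (resp. $\mathcal E_A$) is the set of edges with both endpoints in the PT (resp. alternative) layer, and $\mathcal E^i_P$, $\mathcal E^i_A$ are the subsets of edges with both endpoints in region $i$. Each edge $e$ has an existing status $\hat x_e\in\{0,1\}$, an existing capacity $\hat c_e\in[0,\infty]$ and a length $l_e\ge 0$. For $e\in\mathcal E_P$ let $S(e)\subseteq\mathcal E_A$ be the set of alternative-mode edges that replace $e$ when PT is unavailable on it; replacements stay in the region: $S(e)\subseteq\mathcal E^i_A$ for $e\in\mathcal E^i_P$. \emph{Parameters.} Let $\gamma_{\mathrm{vot}},\gamma_P,\gamma_A,\gamma^P,\gamma^A,c^b,c^k,\kappa,s_{\max}\ge0$ (value of time, prices, unit emissions, unit costs, capacity per unit of frequency, maximum frequency), speeds $v_P,v_A>0$, $\Omega>0$, and for each operator $i$ weights $\omega^e_i,\omega^c_i,\omega^p_i\ge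 0$, a budget $B_i\ge0$ and $\beta_i\in[0,1]$. Write $k_P=\gamma_{\mathrm{vot}}/v_P+\gamma_P$ and $k_A=\gamma_{\mathrm{vot}}/v_A+\gamma_A$. \emph{Strategies.} A (relaxed) strategy of operator $i$ is $h_i=(d_e,s_e)_{e\in\mathcal E^i_P}$ with real $d_e,s_e$. With $x_e=\hat x_e+d_e$, it is feasible if for all $e\in\mathcal E^i_P$ $$d_e\in[0,1],\quad x_e\in[0,1],\quad s_e\in[0,s_{\max}],\quad x_e\le s_e\le \Omega x_e,$$ and $\sum_{e\in\mathcal E^i_P}(c^b l_e d_e+c^k l_e s_e)\le(1-\beta_i)B_i$. For edges lying in no $\mathcal E^i_P$ put $d_e=s_e=0$. Put $c_e=\hat c_e+\kappa s_e$. \emph{Demand.} There are finitely many requests $m\in\mathcal M$, each with a number of trips $\alpha_m\in\mathbb N_0$ and two routes with edge sets $\mathcal E^P_m\subseteq\mathcal E_P$, $\mathcal E^A_m\subseteq\mathcal E_A$. Let $$u^A_m=-\sum_{e\in\mathcal E^A_m}l_ek_A,\qquad u^P_m=-\sum_{e\in\mathcal E^P_m}\Big(x_el_ek_P+(1-x_e)\sum_{a\in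 S(e)}l_ak_A\Big),\qquad p_m=\frac{e^{u^P_m}}{e^{u^A_m}+e^{u^P_m}}.$$ A profile $h=(h_i)_i$ induces the flow $y=\mathcal Y(h)$ given by $y_e=\min\{\sum_{m:\,e\in\mathcal E^P_m}\alpha_mp_m,\;c_e\}$ for $e\in\mathcal E_P$ and, for every other edge, $$y_e=\sum_{m\in\mathcal M}\Big(\mathbf 1[e\in\mathcal E^A_m]\,\alpha_m\hat p_e-\sum_{a\in\mathcal E^P_m}\mathbf 1[e\in S(a)]\,y_a\Big),$$ where $\hat p_e\in\mathbb R$ are given constants (maximum achievable PT shares). \emph{Payoffs.} $f_i(h_i,y)=-\omega^e_iJ^e_i(y)-\omega^c_iJ^c_i(y)+\omega^p_iJ^p_i(h_i,y)$, where $$J^e_i=\sum_{e\in\mathcal E^i_P}\gamma^Pl_ey_e+\sum_{e\in\mathcal E^i_A}\gamma^Al_ey_e,\qquad J^c_i=\sum_{e\in\mathcal E^i_P}l_ey_ek_P+\sum_{e\in\mathcal E^i_A}l_ey_ek_A,$$ $$J^p_i=\sum_{e\in\mathcal E^i_P}\gamma_Pl_ey_e-\sum_{e\in\mathcal E^i_P}(c^bl_ex_e+c^kl_es_e).$$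 \emph{Statement.} Assume that every operator has a feasible strategy, that $u^A_m\le u^P_m$ for every request $m$ at every profile of feasible strategies, and that for every operator $i$ and every $e\in\mathcal E^i_P$ $$\Delta_e=-l_e\big(\omega^e_i\gamma^P+\omega^c_ik_P-\omega^p_i\gamma_P\big)+\sum_{a\in S(e)}l_a\big(\omega^e_i\gamma^A+\omega^c_ik_A\big)\ge0 .$$ Then a pure Nash equilibrium exists: there is a profile $h$ such that, for every $i$, $h_i$ is feasible and $f_i(h_i,\mathcal Y(h_i,h_{-i}))\ge f_i(h_i',\mathcal Y(h_i',h_{-i}))$ for every feasible $h_i'$. -/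

import Mathlib

open scoped NNReal ENNReal

/-- The two layers of the mobility network: public transport and alternative modes. -/
inductive Layer
  | transit
  | alternative
  deriving DecidableEq

/-- A mobility network whose vertices are partitioned into the regions of `N` operators and into
two layers, with directed edges carrying the labels of the existing configuration. Label values
outside `edges` are never used. -/
structure MobilityNetwork (N : ℕ) (V : Type*) where
  edges : Finset (V × V)
  /-- the region (operator) to which a vertex belongs -/
  region : V → Fin N
  layer : V → Layer
  /-- existing construction status of an edge -/
  xhat : V × V → ℝ
  xhat_binary : ∀ e, xhat e = 0 ∨ xhat e = 1
  /-- existing capacity, possibly infinite -/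
  chat : V × V → ℝ≥0∞
  length : V × V → ℝ≥0
  travelTime : V × V → ℝ≥0

namespace MobilityNetwork

variable {N : ℕ} {V : Type*} (Γ : MobilityNetwork N V)

/-- All public transport edges (inside regions and between regions). -/
def ptEdges : Finset (V × V) :=
  Γ.edges.filter fun e => Γ.layer e.1 = Layer.transit ∧ Γ.layer e.2 = Layer.transit

/-- All alternative-mode edges (inside regions and between regions). -/
def altEdges : Finset (V × V) :=
  Γ.edges.filter fun e => Γ.layer e.1 = Layer.alternative ∧ Γ.layer e.2 = Layer.alternative

/-- Public transport edges with both endpoints in region `i`. -/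
def regionPT (i : Fin N) : Finset (V × V) :=
  Γ.ptEdges.filter fun e => Γ.region e.1 = i ∧ Γ.region e.2 = i

/-- Alternative-mode edges with both endpoints in region `i`. -/
def regionAlt (i : Fin N) : Finset (V × V) :=
  Γ.altEdges.filter fun e => Γ.region e.1 = i ∧ Γ.region e.2 = i

end MobilityNetwork

/-- A travel request, with the edge sets of its two route options. -/
structure TravelRequest {N : ℕ} {V : Type*} (Γ : MobilityNetwork N V) where
  origin : V
  destination : V
  origin_layer : Γ.layer origin = Layer.alternative
  destination_layer : Γ.layer destination = Layer.alternative
  /-- number of trips -/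
  trips : ℕ
  /-- edge set of the public-transport-prioritized route -/
  ptRoute : Finset (V × V)
  ptRoute_subset : ptRoute ⊆ Γ.ptEdges
  /-- edge set of the alternative route -/
  altRoute : Finset (V × V)
  altRoute_subset : altRoute ⊆ Γ.altEdges

/-- The data of the network design game of `N` regional operators; `M` indexes the requests. -/
structure NetworkDesignGame (N : ℕ) (V M : Type*) where
  Γ : MobilityNetwork N V
  request : M → TravelRequest Γ
  /-- the alternative-mode edges that substitute a public transport edge when it is unavailable -/
  substitutes : V × V → Finset (V × V)
  substitutes_subset : ∀ e ∈ Γ.ptEdges, substitutes e ⊆ Γ.altEdges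
  /-- maximum achievable public transport mode share, for each alternative-mode edge;
  any given values are allowed -/
  phat : V × V → ℝ
  /-- value of time -/
  vot : ℝ
  vot_nonneg : 0 ≤ vot
  /-- average speeds -/
  speedP : ℝ
  speedP_pos : 0 < speedP
  speedA : ℝ
  speedA_pos : 0 < speedA
  /-- distance-based prices -/
  priceP : ℝ
  priceP_nonneg : 0 ≤ priceP
  priceA : ℝ
  priceA_nonneg : 0 ≤ priceA
  /-- unit emissions -/
  emissionP : ℝ
  emissionP_nonneg : 0 ≤ emissionP
  emissionA : ℝ
  emissionA_nonneg : 0 ≤ emissionA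
  /-- unit cost of line construction -/
  costBase : ℝ
  costBase_nonneg : 0 ≤ costBase
  /-- unit cost of frequency enhancement -/
  costFreq : ℝ
  costFreq_nonneg : 0 ≤ costFreq
  /-- capacity per unit of service frequency -/
  kappa : ℝ
  kappa_nonneg : 0 ≤ kappa
  /-- maximum service frequency -/
  smax : ℝ
  smax_nonneg : 0 ≤ smax
  /-- the large constant linking frequency and availability -/
  bigOmega : ℝ
  bigOmega_pos : 0 < bigOmega
  /-- operators' weights of emissions, travel cost and profit -/
  wE : Fin N → ℝ
  wE_nonneg : ∀ i, 0 ≤ wE i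
  wC : Fin N → ℝ
  wC_nonneg : ∀ i, 0 ≤ wC i
  wP : Fin N → ℝ
  wP_nonneg : ∀ i, 0 ≤ wP i
  /-- budgets -/
  budget : Fin N → ℝ
  budget_nonneg : ∀ i, 0 ≤ budget i
  /-- co-investment ratios -/
  beta : Fin N → ℝ
  beta_mem : ∀ i, beta i ∈ Set.Icc (0 : ℝ) 1

namespace NetworkDesignGame

variable {N : ℕ} {V M : Type*} (G : NetworkDesignGame N V M)

/-- A relaxed strategy of operator `i`: a pair `(d_e, s_e)` (construction, frequency) of real
numbers for each public transport edge of its region. -/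
abbrev Strategy (i : Fin N) : Type _ := {e // e ∈ G.Γ.regionPT i} → ℝ × ℝ

/-- A strategy profile. -/
abbrev Profile : Type _ := (i : Fin N) → G.Strategy i

/-- The feasible set of the relaxed local problem of operator `i`: the binary variables `d_e` and
`x_e = xhat_e + d_e` are relaxed to `[0, 1]`. -/
def feasible (i : Fin N) : Set (G.Strategy i) :=
  {h | (∀ e : {e // e ∈ G.Γ.regionPT i},
      (h e).1 ∈ Set.Icc (0 : ℝ) 1 ∧
      (h e).2 ∈ Set.Icc (0 : ℝ) G.smax ∧
      G.Γ.xhat e.1 + (h e).1 ∈ Set.Icc (0 : ℝ) 1 ∧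
      G.Γ.xhat e.1 + (h e).1 ≤ (h e).2 ∧
      (h e).2 ≤ (G.Γ.xhat e.1 + (h e).1) * G.bigOmega) ∧
    ∑ e : {e // e ∈ G.Γ.regionPT i},
        (G.costBase * G.Γ.length e.1 * (h e).1 + G.costFreq * G.Γ.length e.1 * (h e).2)
      ≤ (1 - G.beta i) * G.budget i}

section Demand

variable [DecidableEq V]

/-- The pair `(d_e, s_e)` that a profile assigns to an edge; it is `(0, 0)` for edges that no
operator designs. -/
def decision (h : G.Profile) (e : V × V) : ℝ × ℝ :=
  if he : e ∈ G.Γ.regionPT (G.Γ.region e.1) then h (G.Γ.region e.1) ⟨e, he⟩ else (0, 0)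

/-- Availability `x_e` after the design. -/
def availability (h : G.Profile) (e : V × V) : ℝ :=
  G.Γ.xhat e + (G.decision h e).1

/-- Capacity `c_e` after the design. -/
noncomputable def capacity (h : G.Profile) (e : V × V) : ℝ≥0∞ :=
  G.Γ.chat e + ENNReal.ofReal (G.kappa * (G.decision h e).2)

/-- Utility of the alternative route. -/
noncomputable def altUtility (m : M) : ℝ :=
  -∑ e ∈ (G.request m).altRoute, G.Γ.length e * (G.vot / G.speedA + G.priceA)

/-- Utility of the public-transport-prioritized route. -/
noncomputable def ptUtility (h : G.Profile) (m : M) : ℝ :=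
  -∑ e ∈ (G.request m).ptRoute,
    (G.availability h e * (G.Γ.length e * (G.vot / G.speedP + G.priceP)) +
      (1 - G.availability h e) *
        ∑ a ∈ G.Γ.altEdges, if a ∈ G.substitutes e then
          (G.Γ.length a : ℝ) * (G.vot / G.speedA + G.priceA) else 0)

/-- Logit share of the public-transport-prioritized route. -/
noncomputable def ptShare (h : G.Profile) (m : M) : ℝ :=
  Real.exp (G.ptUtility h m) / (Real.exp (G.altUtility m) + Real.exp (G.ptUtility h m))

variable [Fintype M]

/-- Served flow on a public transport edge: minimum of the demand and the capacity. -/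
noncomputable def ptFlow (h : G.Profile) (e : V × V) : ℝ :=
  (min (ENNReal.ofReal (∑ m, if e ∈ (G.request m).ptRoute then
      ((G.request m).trips : ℝ) * G.ptShare h m else 0)) (G.capacity h e)).toReal

/-- Flow on an edge that is not a public transport edge. -/
noncomputable def altFlow (h : G.Profile) (e : V × V) : ℝ :=
  ∑ m, ((if e ∈ (G.request m).altRoute then ((G.request m).trips : ℝ) * G.phat e else 0) -
    ∑ a ∈ (G.request m).ptRoute, if e ∈ G.substitutes a then G.ptFlow h a else 0)

/-- The travel demand model: the edge flows induced by a strategy profile. -/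
noncomputable def demand (h : G.Profile) (e : V × V) : ℝ :=
  if e ∈ G.Γ.ptEdges then G.ptFlow h e else G.altFlow h e

end Demand

/-- Emissions in region `i`. -/
noncomputable def emissions (i : Fin N) (y : V × V → ℝ) : ℝ :=
  ∑ e ∈ G.Γ.regionPT i, G.emissionP * G.Γ.length e * y e +
    ∑ e ∈ G.Γ.regionAlt i, G.emissionA * G.Γ.length e * y e

/-- Total travel cost in region `i`. -/
noncomputable def travelCost (i : Fin N) (y : V × V → ℝ) : ℝ :=
  ∑ e ∈ G.Γ.regionPT i, G.Γ.length e * y e * (G.vot / G.speedP + G.priceP) +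
    ∑ e ∈ G.Γ.regionAlt i, G.Γ.length e * y e * (G.vot / G.speedA + G.priceA)

/-- Profitability of operator `i`. -/
noncomputable def profit (i : Fin N) (hi : G.Strategy i) (y : V × V → ℝ) : ℝ :=
  ∑ e ∈ G.Γ.regionPT i, G.priceP * G.Γ.length e * y e -
    ∑ e : {e // e ∈ G.Γ.regionPT i},
      (G.costBase * G.Γ.length e.1 * (G.Γ.xhat e.1 + (hi e).1) +
        G.costFreq * G.Γ.length e.1 * (hi e).2)

/-- The payoff `f_i(h_i, y)` of operator `i`. -/
noncomputable def payoff (i : Fin N) (hi : G.Strategy i) (y : V × V → ℝ) : ℝ :=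
  -G.wE i * G.emissions i y - G.wC i * G.travelCost i y + G.wP i * G.profit i hi y

variable [DecidableEq V]

/-- The marginal payoff `Δ_e` of operator `i` for flow on a public transport edge `e`. -/
noncomputable def marginalPayoff (i : Fin N) (e : V × V) : ℝ :=
  -G.Γ.length e * (G.wE i * G.emissionP + G.wC i * (G.vot / G.speedP + G.priceP)
      - G.wP i * G.priceP) +
    ∑ a ∈ G.Γ.altEdges, if a ∈ G.substitutes e then
      (G.Γ.length a : ℝ) * (G.wE i * G.emissionA + G.wC i * (G.vot / G.speedA + G.priceA)) else 0

/-- A pure Nash equilibrium: every operator's strategy is feasible, and no feasible unilateral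
deviation (after which the flows adjust) gives that operator a larger payoff. -/
def IsNashEquilibrium [Fintype M] (h : G.Profile) : Prop :=
  ∀ i, h i ∈ G.feasible i ∧ ∀ h' ∈ G.feasible i,
    G.payoff i h' (G.demand (Function.update h i h')) ≤ G.payoff i (h i) (G.demand h)

end NetworkDesignGame

/-!
The game is a concave game on compact convex strategy sets, so a pure equilibrium exists by the
theorem of Nikaido and Isoda.

*Concavity.* The flow on an alternative-mode edge is a constant minus flows on the public
transport edges that it substitutes. Hence an operator's payoff is a linear combination of public
transport flows minus an affine design cost (`payoff_demand_eq`). The coefficient of an edge that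
some request uses is nonnegative: inside the operator's region it is at least `marginalPayoff`,
because replacements stay in the region and every request through the edge contributes the
substitution gain (`flowCoefficient_nonneg`). Edges that no request uses carry no flow. The logit
share is the logistic function of the utility difference, which is affine in the own strategy and
nonnegative at feasible profiles, where the logistic function is concave (`concaveOn_ptShare`). So
demand is concave, and so is its minimum with the affine capacity (`concaveOn_ptFlow`).

*Equilibrium of concave games* (`exists_nash_of_concaveOn`). An equilibrium is a profile at which
the total gain from unilateral deviations satisfies Ky Fan's inequality. That inequality
(`exists_forall_nonpos_of_concaveOn`) reduces by compactness to finitely many deviations, where a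
fixed point of Nash's map on a standard simplex gives it.

*Brouwer's theorem* (`exists_fixedPoint_of_mapsTo_stdSimplex`). It is deduced from Scarf's lemma
on rainbow dominating sets (`exists_isDominating_rainbow`), applied to the lattice points of the
simplex ordered by their coordinates. Scarf's lemma needs no triangulation: in its parity argument
the role of adjacent cells is played by the two dominating sets that contain a common face
(`even_card_dominatingExtensions`).
-/

/-! ### Dominating sets of a family of linear orders -/

section Scarf

variable {I E : Type*}

/-- A set `S` of elements of `E`, which carries the linear orders induced by the functions `r i`,
is dominating if no element of `E` lies, in every one of these orders, strictly above some element
of `S`; equivalently, no `y` exceeds the `r i`-least element of `S` for all `i` at once. -/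
def IsDominating (r : I → E → ℕ) (S : Finset E) : Prop :=
  ∀ y, ∃ i, ∀ x ∈ S, r i y ≤ r i x

theorem IsDominating.mono {r : I → E → ℕ} {R S : Finset E} (h : IsDominating r S) (hRS : R ⊆ S) :
    IsDominating r R := fun y => by
  obtain ⟨i, hi⟩ := h y
  exact ⟨i, fun x hx => hi x (hRS hx)⟩

/-- In a dominating set with as many elements as there are orders, every element is the least one
in exactly one order. Removing the element `s` therefore changes the least element in a single
order `a`, and `s` is the `r a`-greatest of the elements that exceed the minima `m i` of the
remaining face `R` in all the other orders. -/
theorem exists_minimum_index [Fintype I] [DecidableEq I] [DecidableEq E]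
    {r : I → E → ℕ} (hr : ∀ i, Function.Injective (r i)) {R : Finset E} {s : E}
    (hs : s ∉ R) (hcard : R.card + 1 = Fintype.card I)
    (h : IsDominating r (insert s R)) (m : I → E) (hm : ∀ i, m i ∈ R)
    (hmin : ∀ i, ∀ x ∈ R, r i (m i) ≤ r i x) :
    ∃ a, r a s < r a (m a) ∧ (∀ i, i ≠ a → r i (m i) < r i s) ∧
      (∀ y, (∀ i, i ≠ a → r i (m i) < r i y) → r a y ≤ r a s) ∧
      Set.InjOn m {a}ᶜ ∧ ∀ x ∈ R, ∃ i, i ≠ a ∧ m i = x := by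
  have hcard' : (insert s R).card = Fintype.card I := by rw [Finset.card_insert_of_notMem hs, hcard]
  choose f hf using h
  have hfinj : Set.InjOn f (insert s R : Finset E) := fun x hx y hy hxy =>
    hr (f x) (le_antisymm (hf x y hy) (by rw [hxy]; exact hf y x hx))
  have himg : (insert s R).image f = Finset.univ := by
    apply Finset.eq_univ_of_card
    rw [Finset.card_image_of_injOn hfinj, hcard']
  have hsS : s ∈ insert s R := Finset.mem_insert_self _ _
  have hne : ∀ x ∈ R, x ≠ s := fun x hx h => hs (h ▸ hx)
  have hmf : ∀ x ∈ R, m (f x) = x := fun x hx =>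
    hr (f x) (le_antisymm (hmin _ x hx) (hf x _ (Finset.mem_insert_of_mem (hm _))))
  have hsur : ∀ i, i ≠ f s → ∃ x ∈ R, f x = i := fun i hi => by
    have : i ∈ (insert s R).image f := himg ▸ Finset.mem_univ i
    obtain ⟨x, hx, rfl⟩ := Finset.mem_image.1 this
    rcases Finset.mem_insert.1 hx with rfl | hx
    · exact absurd rfl hi
    · exact ⟨x, hx, rfl⟩
  have hmlt : ∀ i, i ≠ f s → r i (m i) < r i s := fun i hi => by
    obtain ⟨x, hx, rfl⟩ := hsur i hi
    rw [hmf x hx]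
    exact lt_of_le_of_ne (hf x s hsS) fun h => hne x hx (hr _ h)
  refine ⟨f s, ?_, hmlt, ?_, ?_, ?_⟩
  · exact lt_of_le_of_ne (hf s _ (Finset.mem_insert_of_mem (hm _)))
      fun h => hne _ (hm _) (hr _ h).symm
  · intro y hy
    by_cases hya : f y = f s
    · rw [← hya]
      exact hf y s hsS
    · exact absurd (hf y _ (Finset.mem_insert_of_mem (hm (f y)))) (not_le.2 (hy _ hya))
  · intro i hi j hj hij
    obtain ⟨x, hx, rfl⟩ := hsur i hi
    obtain ⟨y, hy, rfl⟩ := hsur j hj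
    rw [hmf x hx, hmf y hy] at hij
    rw [hij]
  · intro x hx
    refine ⟨f x, fun h => hne x hx (hfinj (Finset.mem_insert_of_mem hx) hsS h), hmf x hx⟩

/-- Converse of `exists_minimum_index`: the `r a`-greatest of the elements that exceed the minima
of `R` in all orders but `a` completes `R` to a dominating set. -/
theorem isDominating_insert_of_max [DecidableEq E] {r : I → E → ℕ} {R : Finset E}
    (m : I → E) (hmin : ∀ i, ∀ x ∈ R, r i (m i) ≤ r i x) {a : I} {s : E}
    (hsa : r a s ≤ r a (m a)) (hs : ∀ i, i ≠ a → r i (m i) < r i s)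
    (hmax : ∀ y, (∀ i, i ≠ a → r i (m i) < r i y) → r a y ≤ r a s) :
    IsDominating r (insert s R) := by
  intro y
  by_cases hy : ∀ i, i ≠ a → r i (m i) < r i y
  · refine ⟨a, fun x hx => ?_⟩
    rcases Finset.mem_insert.1 hx with rfl | hx
    · exact hmax y hy
    · exact (hmax y hy).trans (hsa.trans (hmin a x hx))
  · push Not at hy
    obtain ⟨i, hia, hi⟩ := hy
    refine ⟨i, fun x hx => ?_⟩
    rcases Finset.mem_insert.1 hx with rfl | hx
    · exact hi.trans (hs i hia).le
    · exact hi.trans (hmin i x hx)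

/-- The elements outside `R` whose addition to `R` gives a dominating set. -/
noncomputable def dominatingExtensions [Fintype E] [DecidableEq E] (r : I → E → ℕ)
    (R : Finset E) : Finset E := by
  classical exact Finset.univ.filter fun s => s ∉ R ∧ IsDominating r (insert s R)

theorem mem_dominatingExtensions [Fintype E] [DecidableEq E] {r : I → E → ℕ} {R : Finset E}
    {s : E} :
    s ∈ dominatingExtensions r R ↔ s ∉ R ∧ IsDominating r (insert s R) := by
  simp [dominatingExtensions]

/-- The elements `s i` are slacks for the orders `r`: `s i` is the least element in the order `i`,
and in every other order it lies above all elements that are not slacks. They play the role of the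
vertices of a simplex that surrounds the other elements. -/
structure IsSlack (r : I → E → ℕ) (s : I → E) : Prop where
  injective : Function.Injective s
  least : ∀ i y, r i (s i) ≤ r i y
  large : ∀ i j y, j ≠ i → (∀ k, y ≠ s k) → r i y < r i (s j)

/-- The pivoting step: a face with one element fewer than there are orders, not made of slacks
only, is contained in no or in exactly two dominating sets. The two orders in which the face has
the same least element are the ones that the added element can take over. -/
theorem even_card_dominatingExtensions [Fintype I] [DecidableEq I] [Fintype E] [DecidableEq E]
    {r : I → E → ℕ} (hr : ∀ i, Function.Injective (r i))
    {s : I → E} (hs : IsSlack r s) {R : Finset E} (hcard : R.card + 1 = Fintype.card I)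
    {t : E} (htR : t ∈ R) (ht : ∀ k, t ≠ s k) : Even (dominatingExtensions r R).card := by
  by_cases hemp : dominatingExtensions r R = ∅
  · simp [hemp]
  obtain ⟨z, hz⟩ := Finset.nonempty_iff_ne_empty.2 hemp
  rw [mem_dominatingExtensions] at hz
  obtain ⟨hzR, hz⟩ := hz
  have hRdom : IsDominating r R := hz.mono (Finset.subset_insert _ _)
  have : ∀ i, ∃ x ∈ R, ∀ y ∈ R, r i x ≤ r i y := fun i => R.exists_min_image (r i) ⟨t, htR⟩
  choose m hm hmin using this
  obtain ⟨a, ha1, ha2, ha3, hainj, hasur⟩ := exists_minimum_index hr hzR hcard hz m hm hmin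
  obtain ⟨b, hba, hmb⟩ := hasur (m a) (hm a)
  -- Every index that can be skipped is one of the two indices with the same minimum.
  have hskip : ∀ c, (∀ x ∈ R, ∃ i, i ≠ c ∧ m i = x) → c = a ∨ c = b := by
    intro c hc
    by_contra! hcon
    obtain ⟨i, hic, hi⟩ := hc (m c) (hm c)
    by_cases hia : i = a
    · subst hia
      exact hcon.2 (hainj hcon.1 hba (by rw [← hi, hmb]))
    · exact hic (hainj hia hcon.1 hi)
  have hbsur : ∀ x ∈ R, ∃ i, i ≠ b ∧ m i = x := by
    intro x hx
    obtain ⟨i, hia, rfl⟩ := hasur x hx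
    by_cases hib : i = b
    · exact ⟨a, hba.symm, by rw [hib, hmb]⟩
    · exact ⟨i, hib, rfl⟩
  have hmem : ∀ c, (∀ x ∈ R, ∃ i, i ≠ c ∧ m i = x) →
      ∃ w, (∀ i, i ≠ c → r i (m i) < r i w) ∧
        (∀ y, (∀ i, i ≠ c → r i (m i) < r i y) → r c y ≤ r c w) ∧ r c w < r c (m c) ∧
        w ∈ dominatingExtensions r R := by
    intro c hcsur
    -- The slack of the skipped index is a candidate.
    have hmt : ∀ i k, k ≠ i → m i ≠ s k := fun i k hk h =>
      absurd (hmin i t htR) (not_le.2 (h ▸ hs.large i k t hk ht))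
    obtain ⟨d, hdc, hmd⟩ := hcsur (m c) (hm c)
    have hcand : ∀ i, i ≠ c → r i (m i) < r i (s c) := by
      intro i hic
      by_cases hmi : ∃ k, m i = s k
      · obtain ⟨k, hk⟩ := hmi
        have hki : k = i := by
          by_contra hki
          exact hmt i k hki hk
        subst hki
        rw [hk]
        exact lt_of_le_of_ne (hs.least _ _) fun h => hic (hs.injective (hr _ h))
      · push Not at hmi
        exact hs.large i c _ (Ne.symm hic) hmi
    obtain ⟨w, hw, hwmax⟩ :=
      (Finset.univ.filter fun w => ∀ i, i ≠ c → r i (m i) < r i w).exists_max_image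
        (r c) ⟨s c, by simpa using hcand⟩
    simp only [Finset.mem_filter, Finset.mem_univ, true_and] at hw hwmax
    have hwR : w ∉ R := fun hwR => by
      obtain ⟨i, hic, hi⟩ := hcsur w hwR
      exact absurd (hw i hic) (by rw [hi]; exact lt_irrefl _)
    have hwc : r c w < r c (m c) := by
      obtain ⟨i, hi⟩ := hRdom w
      have hic : i = c := by
        by_contra hic
        exact absurd (hi _ (hm i)) (not_le.2 (hw i hic))
      subst hic
      exact lt_of_le_of_ne (hi _ (hm i)) fun h => hwR (hr _ h ▸ hm i)
    exact ⟨w, hw, hwmax, hwc, mem_dominatingExtensions.2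
      ⟨hwR, isDominating_insert_of_max m hmin hwc.le hw hwmax⟩⟩
  obtain ⟨u, hu1, hu2, hu3, hu4⟩ := hmem a hasur
  obtain ⟨v, hv1, hv2, hv3, hv4⟩ := hmem b hbsur
  have huv : u ≠ v := fun h => by
    subst h
    exact absurd (hu1 b hba) (not_lt.2 hv3.le)
  have : dominatingExtensions r R = {u, v} := by
    ext w
    simp only [Finset.mem_insert, Finset.mem_singleton]
    constructor
    · intro hw
      rw [mem_dominatingExtensions] at hw
      obtain ⟨c, hc1, hc2, hc3, -, hcsur⟩ := exists_minimum_index hr hw.1 hcard hw.2 m hm hmin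
      rcases hskip c hcsur with rfl | rfl
      · exact Or.inl (hr _ (le_antisymm (hu2 w hc2) (hc3 u hu1)))
      · exact Or.inr (hr _ (le_antisymm (hv2 w hc2) (hc3 v hv1)))
    · rintro (rfl | rfl) <;> assumption
  rw [this, Finset.card_pair huv]
  exact even_two

/-- The boundary face of all slacks but one extends in exactly one way: by the greatest element,
in the order of the missing slack, outside the face. -/
theorem card_dominatingExtensions_slack [Fintype I] [DecidableEq I] [Fintype E] [DecidableEq E]
    {r : I → E → ℕ} (hr : ∀ i, Function.Injective (r i))
    {s : I → E} (hs : IsSlack r s) (o : I) :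
    (dominatingExtensions r ((Finset.univ.erase o).image s)).card = 1 := by
  set R := (Finset.univ.erase o).image s with hR
  have hmemR : ∀ x, x ∈ R ↔ ∃ i, i ≠ o ∧ s i = x := by simp [hR]
  have hoR : s o ∉ R := by
    rw [hmemR]
    rintro ⟨i, hi, h⟩
    exact hi (hs.injective h)
  have hnotR : ∀ x, x ∉ R → x = s o ∨ ∀ k, x ≠ s k := by
    intro x hx
    by_contra! hcon
    obtain ⟨k, hk⟩ := hcon.2
    refine hx ((hmemR x).2 ⟨k, ?_, hk.symm⟩)
    rintro rfl
    exact hcon.1 hk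
  -- An element outside the face lies, in the order `o`, below all slacks of the face.
  have hbelow : ∀ x, x ∉ R → ∀ z ∈ R, r o x ≤ r o z := by
    intro x hx z hz
    rcases hnotR x hx with rfl | hx
    · exact hs.least _ _
    · obtain ⟨i, hi, rfl⟩ := (hmemR z).1 hz
      exact (hs.large o i x hi hx).le
  obtain ⟨w, hw, hwmax⟩ := (Finset.univ.filter fun w => w ∉ R).exists_max_image
      (r o) ⟨s o, by simpa using hoR⟩
  simp only [Finset.mem_filter, Finset.mem_univ, true_and] at hw hwmax
  rw [Finset.card_eq_one]
  refine ⟨w, ?_⟩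
  ext x
  rw [mem_dominatingExtensions, Finset.mem_singleton]
  constructor
  · rintro ⟨hx, hdom⟩
    obtain ⟨i, hi⟩ := hdom w
    have hio : i = o := by
      by_contra hio
      have h1 : s i ∈ R := (hmemR _).2 ⟨i, hio, rfl⟩
      have := hr i (le_antisymm (hi _ (Finset.mem_insert_of_mem h1)) (hs.least i w))
      exact hw (this ▸ h1)
    subst hio
    exact hr i (le_antisymm (hwmax x hx) (hi _ (Finset.mem_insert_self _ _)))
  · rintro rfl
    refine ⟨hw, fun y => ?_⟩
    by_cases hy : y ∈ R
    · obtain ⟨i, -, rfl⟩ := (hmemR y).1 hy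
      exact ⟨i, fun z _ => hs.least i z⟩
    · refine ⟨o, fun z hz => ?_⟩
      rcases Finset.mem_insert.1 hz with rfl | hz
      · exact hwmax y hy
      · exact hbelow y hy z hz

end Scarf

/-! ### Scarf's lemma -/

section Rainbow

variable {I E : Type*} [Fintype I] [DecidableEq I] [DecidableEq E]

/-- A set with as many elements as there are colours that misses a colour has no or exactly two
elements whose removal leaves precisely the colours other than `o`: these two share a colour. -/
theorem even_card_nearlyRainbow_erase (c : E → I) (o : I) {S : Finset E}
    (hcard : S.card = Fintype.card I) (hS : S.image c ≠ Finset.univ) :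
    Even (S.filter fun x => (S.erase x).image c = Finset.univ.erase o).card := by
  by_cases hemp : (S.filter fun x => (S.erase x).image c = Finset.univ.erase o) = ∅
  · simp [hemp]
  obtain ⟨x, hx⟩ := Finset.nonempty_iff_ne_empty.2 hemp
  obtain ⟨hxS, hx⟩ := Finset.mem_filter.1 hx
  have hinj : Set.InjOn c (S.erase x : Finset E) := by
    rw [← Finset.card_image_iff, hx, Finset.card_erase_of_mem hxS,
      Finset.card_erase_of_mem (Finset.mem_univ o), hcard, Finset.card_univ]
  have hxo : c x ≠ o := by
    intro hxo
    apply hS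
    rw [← Finset.insert_erase hxS, Finset.image_insert, hx, hxo,
      Finset.insert_erase (Finset.mem_univ o)]
  obtain ⟨z, hz, hzx⟩ : ∃ z ∈ S.erase x, c z = c x := by
    rw [← Finset.mem_image, hx]
    simpa using hxo
  obtain ⟨hzne, hzS⟩ := Finset.mem_erase.1 hz
  have : (S.filter fun x => (S.erase x).image c = Finset.univ.erase o) = {x, z} := by
    ext w
    simp only [Finset.mem_filter, Finset.mem_insert, Finset.mem_singleton]
    constructor
    · rintro ⟨hwS, hw⟩
      by_contra! hcon
      have hinjw : Set.InjOn c (S.erase w : Finset E) := by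
        rw [← Finset.card_image_iff, hw, Finset.card_erase_of_mem hwS,
          Finset.card_erase_of_mem (Finset.mem_univ o), hcard, Finset.card_univ]
      exact hzne (hinjw (Finset.mem_coe.2 (Finset.mem_erase.2 ⟨hcon.2.symm, hzS⟩))
        (Finset.mem_coe.2 (Finset.mem_erase.2 ⟨hcon.1.symm, hxS⟩)) hzx)
    · rintro (rfl | rfl)
      · exact ⟨hxS, hx⟩
      · refine ⟨hzS, ?_⟩
        rw [← hx]
        have h1 : S.erase x = insert w ((S.erase x).erase w) := (Finset.insert_erase hz).symm
        have h2 : S.erase w = insert x ((S.erase x).erase w) := by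
          rw [Finset.erase_right_comm,
            Finset.insert_erase (Finset.mem_erase.2 ⟨hzne.symm, hxS⟩)]
        rw [h1, h2, Finset.image_insert, Finset.image_insert, hzx]
  rw [this, Finset.card_pair hzne.symm]
  exact even_two

/-- **Scarf's lemma**: if the slacks carry their own index as colour, some dominating set shows
every colour exactly once. Otherwise count the pairs of a dominating set `S` with `Fintype.card I`
elements and a face of `S` with exactly the colours other than `o`. By sets, the count is even
(`even_card_nearlyRainbow_erase`). By faces, it is odd, because the face of all slacks but `o`
contributes one pair and every other face an even number. -/
theorem exists_isDominating_rainbow [Fintype E] [Nonempty I] {r : I → E → ℕ}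
    (hr : ∀ i, Function.Injective (r i)) {s : I → E} (hs : IsSlack r s) (c : E → I)
    (hc : ∀ i, c (s i) = i) :
    ∃ S : Finset E, IsDominating r S ∧ S.card = Fintype.card I ∧ S.image c = Finset.univ := by
  classical
  by_contra! hcon
  let o : I := Classical.arbitrary I
  let rooms : Finset (Finset E) :=
    Finset.univ.filter fun S => IsDominating r S ∧ S.card = Fintype.card I
  let doors : Finset (Finset E) :=
    Finset.univ.filter fun R => R.card + 1 = Fintype.card I ∧ R.image c = Finset.univ.erase o
  have hcount := Finset.sum_card_bipartiteAbove_eq_sum_card_bipartiteBelow (s := doors)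
    (t := rooms) (fun R S => R ⊆ S)
  have hroom : ∀ S ∈ rooms, Even (Finset.bipartiteBelow (fun R S => R ⊆ S) doors S).card := by
    intro S hS
    obtain ⟨hdom, hcard⟩ : IsDominating r S ∧ S.card = Fintype.card I := by simpa [rooms] using hS
    have : Finset.bipartiteBelow (fun R S => R ⊆ S) doors S =
        (S.filter fun x => (S.erase x).image c = Finset.univ.erase o).image S.erase := by
      ext R
      simp only [Finset.bipartiteBelow, doors, Finset.mem_filter, Finset.mem_univ, true_and,
        Finset.mem_image]
      constructor
      · rintro ⟨⟨h1, h2⟩, h3⟩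
        obtain ⟨x, hx⟩ : ∃ x, S \ R = {x} := by
          rw [← Finset.card_eq_one, Finset.card_sdiff_of_subset h3]
          omega
        have hR : S.erase x = R := by
          rw [← Finset.sdiff_singleton_eq_erase, ← hx, Finset.sdiff_sdiff_eq_self h3]
        have hxS : x ∈ S := (Finset.mem_sdiff.1 (hx ▸ Finset.mem_singleton_self x)).1
        exact ⟨x, ⟨hxS, by rw [hR, h2]⟩, hR⟩
      · rintro ⟨x, ⟨hxS, hx⟩, rfl⟩
        refine ⟨⟨?_, hx⟩, Finset.erase_subset _ _⟩
        rw [Finset.card_erase_add_one hxS, hcard]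
    rw [this, Finset.card_image_of_injOn]
    · exact even_card_nearlyRainbow_erase c o hcard (hcon S hdom hcard)
    · exact (Finset.erase_injOn S).mono (Finset.coe_subset.2 (Finset.filter_subset _ _))
  have hdoor : ∀ R ∈ doors, (Finset.bipartiteAbove (fun R S => R ⊆ S) rooms R).card =
      (dominatingExtensions r R).card := by
    intro R hR
    obtain ⟨hcard, -⟩ : R.card + 1 = Fintype.card I ∧ R.image c = Finset.univ.erase o := by
      simpa [doors] using hR
    have : Finset.bipartiteAbove (fun R S => R ⊆ S) rooms R =
        (dominatingExtensions r R).image fun x => insert x R := by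
      ext S
      simp only [Finset.bipartiteAbove, rooms, Finset.mem_filter, Finset.mem_univ, true_and,
        Finset.mem_image, mem_dominatingExtensions]
      constructor
      · rintro ⟨⟨h1, h2⟩, h3⟩
        obtain ⟨x, hx⟩ : ∃ x, S \ R = {x} := by
          rw [← Finset.card_eq_one, Finset.card_sdiff_of_subset h3]
          omega
        have hS : insert x R = S := by
          rw [← Finset.sdiff_union_of_subset h3, hx, Finset.insert_eq]
        have hxR : x ∉ R := (Finset.mem_sdiff.1 (hx ▸ Finset.mem_singleton_self x)).2
        exact ⟨x, ⟨hxR, hS ▸ h1⟩, hS⟩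
      · rintro ⟨x, ⟨hxR, hx⟩, rfl⟩
        exact ⟨⟨hx, by rw [Finset.card_insert_of_notMem hxR, hcard]⟩, Finset.subset_insert _ _⟩
    rw [this, Finset.card_image_of_injOn]
    intro x hx y hy hxy
    have hxR := (mem_dominatingExtensions.1 hx).1
    have : x ∈ insert y R := by
      have h : insert x R = insert y R := hxy
      exact h ▸ Finset.mem_insert_self x R
    exact (Finset.mem_insert.1 this).resolve_right hxR
  let R₀ : Finset E := (Finset.univ.erase o).image s
  have hR₀card : R₀.card + 1 = Fintype.card I := by
    rw [Finset.card_image_of_injective _ hs.injective,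
      Finset.card_erase_add_one (Finset.mem_univ o), Finset.card_univ]
  have hR₀ : R₀ ∈ doors := by
    simp only [doors, Finset.mem_filter, Finset.mem_univ, true_and]
    refine ⟨hR₀card, ?_⟩
    rw [Finset.image_image]
    exact (Finset.image_congr fun i _ => hc i).trans Finset.image_id
  have hother : ∀ R ∈ doors.erase R₀, Even (dominatingExtensions r R).card := by
    intro R hR
    obtain ⟨hne, hR⟩ := Finset.mem_erase.1 hR
    obtain ⟨hcard, himg⟩ : R.card + 1 = Fintype.card I ∧ R.image c = Finset.univ.erase o := by
      simpa [doors] using hR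
    obtain ⟨t, htR, ht⟩ : ∃ t ∈ R, ∀ k, t ≠ s k := by
      by_contra! hall
      refine hne (Finset.eq_of_subset_of_card_le (fun x hx => ?_) (by omega))
      obtain ⟨k, rfl⟩ := hall x hx
      refine Finset.mem_image_of_mem _ ?_
      rw [← himg]
      exact Finset.mem_image.2 ⟨s k, hx, hc k⟩
    exact even_card_dominatingExtensions hr hs hcard htR ht
  rw [Finset.sum_congr rfl hdoor, ← Finset.add_sum_erase _ _ hR₀,
    card_dominatingExtensions_slack hr hs o] at hcount
  have h1 : Even (∑ R ∈ doors.erase R₀, (dominatingExtensions r R).card) :=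
    Finset.even_sum _ hother
  have h2 := Finset.even_sum _ hroom
  rw [← hcount, add_comm, Nat.even_add_one] at h2
  exact h2 h1

/-- Scarf's lemma without slacks, for arbitrary valuations `v i` of a finite set of points with
colours `c`: there are points `σ` such that no point beats all of them in every valuation whose
index is a colour of `σ`. Ties of the valuations are broken by an enumeration of the points. -/
theorem exists_colored_dominating {I T : Type*} [Fintype I] [Nonempty I] [Fintype T] [Nonempty T]
    (v : I → T → ℕ) (c : T → I) :
    ∃ σ : Finset T, σ.Nonempty ∧ ∀ y, ∃ i, (∃ x ∈ σ, c x = i) ∧ ∀ x ∈ σ, v i y ≤ v i x := by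
  classical
  let eT := Fintype.equivFin T
  let eI := Fintype.equivFin I
  -- The slacks of the other indices are placed above the bound `B` for all points.
  obtain ⟨B, hB⟩ : ∃ B, ∀ i t, v i t * Fintype.card T + eT t + 1 < B := by
    refine ⟨∑ i, ∑ t, (v i t * Fintype.card T + eT t + 1) + 1, fun i t => Nat.lt_succ_of_le ?_⟩
    refine le_trans ?_ (Finset.single_le_sum
      (f := fun i => ∑ t, (v i t * Fintype.card T + eT t + 1))
      (fun _ _ => Nat.zero_le _) (Finset.mem_univ i))
    exact Finset.single_le_sum (f := fun t => (v i t * Fintype.card T + eT t + 1))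
      (fun _ _ => Nat.zero_le _) (Finset.mem_univ t)
  let r : I → T ⊕ I → ℕ := fun i =>
    Sum.elim (fun t => v i t * Fintype.card T + eT t + 1) (fun j => if j = i then 0 else B + eI j)
  have hv : ∀ i x y, r i (Sum.inl x) ≤ r i (Sum.inl y) → v i x ≤ v i y := by
    intro i x y h
    by_contra! hlt
    have h1 : (v i y + 1) * Fintype.card T ≤ v i x * Fintype.card T := Nat.mul_le_mul_right _ hlt
    have h2 := (eT y).isLt
    simp only [r, Sum.elim_inl] at h
    rw [add_mul] at h1
    omega
  have hr : ∀ i, Function.Injective (r i) := by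
    rintro i (x | j) (y | k) h
    · have hxy := le_antisymm (hv i x y h.le) (hv i y x h.ge)
      simp only [r, Sum.elim_inl, hxy] at h
      rw [eT.injective (Fin.ext (by omega : (eT x : ℕ) = eT y))]
    · have := hB i x
      simp only [r, Sum.elim_inl, Sum.elim_inr] at h
      split_ifs at h
      all_goals omega
    · have := hB i y
      simp only [r, Sum.elim_inl, Sum.elim_inr] at h
      split_ifs at h
      all_goals omega
    · have h0 := (eI j).isLt
      have hBpos : 0 < B := lt_of_le_of_lt (Nat.zero_le _) (hB i (Classical.arbitrary T))
      simp only [r, Sum.elim_inr] at h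
      split_ifs at h with h1 h2 h2
      · rw [h1, h2]
      · omega
      · omega
      · rw [eI.injective (Fin.ext (by omega : (eI j : ℕ) = eI k))]
  have hs : IsSlack r Sum.inr := by
    refine ⟨Sum.inr_injective, fun i y => by simp [r], ?_⟩
    rintro i j (y | k) hji hy
    · have := hB i y
      simp only [r, Sum.elim_inl, Sum.elim_inr, if_neg hji]
      omega
    · exact absurd rfl (hy k)
  obtain ⟨S, hdom, hcard, himg⟩ := exists_isDominating_rainbow hr hs (Sum.elim c id) fun _ => rfl
  have hinj : Set.InjOn (Sum.elim c id) (S : Set (T ⊕ I)) := by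
    rw [← Finset.card_image_iff, himg, hcard, Finset.card_univ]
  have key : ∀ y, ∃ i, (∃ x, Sum.inl x ∈ S ∧ c x = i) ∧
      ∀ x, Sum.inl x ∈ S → v i y ≤ v i x := by
    intro y
    obtain ⟨i, hi⟩ := hdom (Sum.inl y)
    refine ⟨i, ?_, fun x hx => hv i y x (hi _ hx)⟩
    obtain ⟨x | j, hx, hxi⟩ := Finset.mem_image.1 (himg ▸ Finset.mem_univ i)
    · exact ⟨x, hx, hxi⟩
    · -- The index `i` cannot be represented by its slack, which lies below `y`.
      have hji : j = i := hxi
      subst hji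
      have := hi _ hx
      simp [r] at this
  refine ⟨Finset.univ.filter fun x => Sum.inl x ∈ S, ?_, fun y => ?_⟩
  · obtain ⟨i, ⟨x, hx, -⟩, -⟩ := key (Classical.arbitrary T)
    exact ⟨x, by simpa using hx⟩
  · obtain ⟨i, ⟨x, hx, hxi⟩, h⟩ := key y
    exact ⟨i, ⟨x, by simpa using hx, hxi⟩, fun x hx => h x (by simpa using hx)⟩

end Rainbow

/-! ### Brouwer's fixed point theorem -/

section Brouwer

variable {ι : Type*} [Fintype ι]

/-- Lattice points of the simplex of size `K` that no lattice point beats in all coordinates of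
`C` are close together and nearly vanish outside `C`. For otherwise the coordinatewise minima over
`C` have so small a sum that each of them can be raised by one. -/
theorem lt_add_card_of_dominating {K : ℕ} {σ : Finset (ι → ℕ)} (hσ : σ.Nonempty)
    (hsum : ∀ x ∈ σ, ∑ i, x i = K) {C : Finset ι}
    (hdom : ∀ y : ι → ℕ, ∑ i, y i = K → ∃ i ∈ C, ∀ x ∈ σ, y i ≤ x i) :
    (∀ x ∈ σ, ∀ x' ∈ σ, ∀ i, x i < x' i + Fintype.card ι) ∧
      ∀ x ∈ σ, ∀ i ∉ C, x i < Fintype.card ι := by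
  classical
  have : ∀ i, ∃ x ∈ σ, ∀ y ∈ σ, x i ≤ y i := fun i => σ.exists_min_image (fun x => x i) hσ
  choose g hg hmin using this
  have hlt : K < ∑ i ∈ C, (g i i + 1) := by
    by_contra! hle
    have hC : C.Nonempty := by
      obtain ⟨x, hx⟩ := hσ
      obtain ⟨i, hi, -⟩ := hdom x (hsum x hx)
      exact ⟨i, hi⟩
    obtain ⟨o, ho⟩ := hC
    -- The unused mass goes to the coordinate `o`.
    let y : ι → ℕ := fun i => (if i ∈ C then g i i + 1 else 0) +
      if i = o then K - ∑ i ∈ C, (g i i + 1) else 0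
    have hy : ∑ i, y i = K := by
      simp only [y, Finset.sum_add_distrib, Finset.sum_ite_eq', Finset.mem_univ, if_true]
      rw [Finset.sum_ite_mem, Finset.univ_inter]
      rw [Finset.sum_add_distrib] at hle ⊢
      omega
    obtain ⟨i, hi, h⟩ := hdom y hy
    have := h _ (hg i)
    simp only [y, if_pos hi] at this
    omega
  have hcardC : C.card ≤ Fintype.card ι := Finset.card_le_univ C
  rw [Finset.sum_add_distrib, Finset.sum_const, smul_eq_mul, mul_one] at hlt
  have hout : ∀ x ∈ σ, ∀ i ∉ C, x i < Fintype.card ι := by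
    intro x hx i hi
    have h1 : x i + ∑ j ∈ C, x j ≤ ∑ j, x j := by
      rw [← Finset.sum_insert hi]
      exact Finset.sum_le_sum_of_subset (Finset.subset_univ _)
    have h2 : ∑ j ∈ C, g j j ≤ ∑ j ∈ C, x j := Finset.sum_le_sum fun j _ => hmin j x hx
    rw [hsum x hx] at h1
    omega
  refine ⟨fun x hx x' hx' i => ?_, hout⟩
  by_cases hi : i ∈ C
  · have h1 : ∑ j ∈ C, x j ≤ K := by
      rw [← hsum x hx]
      exact Finset.sum_le_sum_of_subset (Finset.subset_univ _)
    rw [← Finset.add_sum_erase _ _ hi] at h1 hlt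
    have h2 : ∑ j ∈ C.erase i, g j j ≤ ∑ j ∈ C.erase i, x j :=
      Finset.sum_le_sum fun j _ => hmin j x hx
    have h3 := hmin i x' hx'
    omega
  · have := hout x hx i hi
    omega

/-- A continuous self-map of the standard simplex has approximate fixed points. Colour each point
of a fine lattice by a coordinate that the map does not decrease, and apply Scarf's lemma with the
coordinates as valuations: at a point of the resulting small cluster, no coordinate that occurs as
a colour decreases by more than `ε`, and the other coordinates are small anyway. -/
theorem exists_le_map_add_of_mapsTo_stdSimplex [Nonempty ι] {f : (ι → ℝ) → ι → ℝ}
    (hf : ContinuousOn f (stdSimplex ℝ ι)) (hmaps : Set.MapsTo f (stdSimplex ℝ ι) (stdSimplex ℝ ι))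
    {ε : ℝ} (hε : 0 < ε) : ∃ x ∈ stdSimplex ℝ ι, ∀ i, x i ≤ f x i + ε := by
  classical
  have hunif := (isCompact_stdSimplex ℝ ι).uniformContinuousOn_of_continuous hf
  obtain ⟨δ, hδ, hunif⟩ := Metric.uniformContinuousOn_iff.1 hunif (ε / 2) (half_pos hε)
  set η := min δ (ε / 2) with hη
  have hηpos : 0 < η := lt_min hδ (half_pos hε)
  obtain ⟨K, hK⟩ := exists_nat_gt ((Fintype.card ι : ℝ) / η)
  have hKpos : (0 : ℝ) < K := lt_of_le_of_lt (by positivity) hK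
  have hKη : (Fintype.card ι : ℝ) / K < η := by
    rw [div_lt_iff₀ hηpos] at hK
    rw [div_lt_iff₀ hKpos]
    linarith
  let T := {z : ι → ℕ // z ∈ Finset.piAntidiag Finset.univ K}
  let _ : Fintype T := inferInstanceAs (Fintype {z // z ∈ Finset.piAntidiag Finset.univ K})
  have hTsum : ∀ z : T, ∑ i, z.1 i = K := fun z => (Finset.mem_piAntidiag.1 z.2).1
  have hmk : ∀ y : ι → ℕ, ∑ i, y i = K → y ∈ Finset.piAntidiag Finset.univ K := fun y hy =>
    Finset.mem_piAntidiag.2 ⟨hy, fun _ _ => Finset.mem_univ _⟩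
  have : Nonempty T := ⟨⟨Pi.single (Classical.arbitrary ι) K, hmk _ (by simp)⟩⟩
  let p : T → ι → ℝ := fun z i => (z.1 i : ℝ) / K
  have hp : ∀ z, p z ∈ stdSimplex ℝ ι := by
    refine fun z => ⟨fun i => by positivity, ?_⟩
    simp only [p]
    rw [← Finset.sum_div, div_eq_one_iff_eq hKpos.ne']
    exact_mod_cast hTsum z
  have hcol : ∀ z, ∃ i, p z i ≤ f (p z) i := by
    intro z
    obtain ⟨i, -, hi⟩ := Finset.exists_le_of_sum_le (s := Finset.univ) (f := p z) (g := f (p z))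
      Finset.univ_nonempty (by rw [(hp z).2, (hmaps (hp z)).2])
    exact ⟨i, hi⟩
  choose c hc using hcol
  obtain ⟨σ, hσ, hdom⟩ := exists_colored_dominating (fun i (z : T) => z.1 i) c
  obtain ⟨hclose, hsmall⟩ := lt_add_card_of_dominating (K := K) (σ := σ.image Subtype.val)
    (hσ.image _) (by simp only [Finset.forall_mem_image]; exact fun z _ => hTsum z)
    (C := σ.image c) (by
      intro y hy
      obtain ⟨i, ⟨x, hx, hxi⟩, h⟩ := hdom ⟨y, hmk y hy⟩
      exact ⟨i, Finset.mem_image.2 ⟨x, hx, hxi⟩, by simpa only [Finset.forall_mem_image] using h⟩)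
  simp only [Finset.forall_mem_image] at hclose hsmall
  have hclose' : ∀ z ∈ σ, ∀ z' ∈ σ, ∀ i, p z i < p z' i + η := by
    intro z hz z' hz' i
    have h : (z.1 i : ℝ) < z'.1 i + Fintype.card ι := by exact_mod_cast hclose hz hz' i
    calc p z i < (z'.1 i + Fintype.card ι) / K := (div_lt_div_iff_of_pos_right hKpos).2 h
      _ = p z' i + Fintype.card ι / K := add_div _ _ _
      _ < p z' i + η := by linarith
  obtain ⟨z, hz⟩ := hσ
  refine ⟨p z, hp z, fun i => ?_⟩
  by_cases hi : i ∈ σ.image c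
  · obtain ⟨w, hw, rfl⟩ := Finset.mem_image.1 hi
    have hdist : dist (p z) (p w) < δ := by
      refine (dist_pi_lt_iff hδ).2 fun j => ?_
      have h1 := hclose' z hz w hw j
      have h2 := hclose' w hw z hz j
      have h3 : η ≤ δ := min_le_left _ _
      rw [Real.dist_eq, abs_lt]
      constructor <;> linarith
    have h1 := (dist_le_pi_dist (f (p z)) (f (p w)) (c w)).trans_lt (hunif _ (hp z) _ (hp w) hdist)
    rw [Real.dist_eq, abs_lt] at h1
    have h2 := hc w
    have h3 := hclose' z hz w hw (c w)
    have h4 : η ≤ ε / 2 := min_le_right _ _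
    linarith [h1.1]
  · have h1 : p z i < Fintype.card ι / K :=
      (div_lt_div_iff_of_pos_right hKpos).2 (by exact_mod_cast hsmall hz i hi)
    have h2 := (hmaps (hp z)).1 i
    have h4 : η ≤ ε / 2 := min_le_right _ _
    linarith

/-- **Brouwer's fixed point theorem** for the standard simplex. By compactness the approximate fixed
points yield `x` with `x ≤ f x`, and both have coordinate sum `1`. -/
theorem exists_fixedPoint_of_mapsTo_stdSimplex [Nonempty ι] {f : (ι → ℝ) → ι → ℝ}
    (hf : ContinuousOn f (stdSimplex ℝ ι))
    (hmaps : Set.MapsTo f (stdSimplex ℝ ι) (stdSimplex ℝ ι)) :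
    ∃ x ∈ stdSimplex ℝ ι, f x = x := by
  classical
  have hcont : ContinuousOn (fun x => ∑ i, max 0 (x i - f x i)) (stdSimplex ℝ ι) := by
    refine continuousOn_finsetSum _ fun i _ => continuousOn_const.sup ?_
    exact (continuous_apply i).continuousOn.sub ((continuous_apply i).comp_continuousOn hf)
  obtain ⟨x, hx, hmin⟩ := (isCompact_stdSimplex ℝ ι).exists_isMinOn
    ⟨_, single_mem_stdSimplex ℝ (Classical.arbitrary ι)⟩ hcont
  have hle : ∑ i, max 0 (x i - f x i) ≤ 0 := by
    refine le_of_forall_pos_le_add fun ε hε => ?_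
    have hn : (0 : ℝ) < Fintype.card ι := by exact_mod_cast Fintype.card_pos
    obtain ⟨y, hy, hyle⟩ := exists_le_map_add_of_mapsTo_stdSimplex hf hmaps (div_pos hε hn)
    calc ∑ i, max 0 (x i - f x i) ≤ ∑ i, max 0 (y i - f y i) := hmin hy
      _ ≤ ∑ _i : ι, ε / Fintype.card ι :=
        Finset.sum_le_sum fun i _ => max_le (by positivity) (by linarith [hyle i])
      _ = 0 + ε := by
        rw [Finset.sum_const, Finset.card_univ, nsmul_eq_mul, zero_add, mul_div_cancel₀ _ hn.ne']
  have hle' : ∀ i, x i ≤ f x i := fun i => by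
    have h := Finset.single_le_sum (f := fun i => max 0 (x i - f x i))
      (fun i _ => le_max_left _ _) (Finset.mem_univ i)
    have := (le_max_right 0 (x i - f x i)).trans (h.trans hle)
    linarith
  have heq := (Finset.sum_eq_sum_iff_of_le (s := Finset.univ) fun i _ => hle' i).1
    (by rw [hx.2, (hmaps hx).2])
  exact ⟨x, hx, funext fun i => (heq i (Finset.mem_univ i)).symm⟩

end Brouwer

/-! ### Ky Fan's inequality and concave games -/

section KyFan

variable {X : Type*} [AddCommGroup X] [Module ℝ X] [TopologicalSpace X] [IsTopologicalAddGroup X]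
  [ContinuousSMul ℝ X]

/-- Ky Fan's inequality against finitely many points `y j`. Brouwer's theorem is applied to Nash's
map, which moves the barycentric weights `t` towards the points `y j` with `φ (∑ t j • y j) (y j)`
positive. -/
theorem exists_forall_nonpos_of_finite {K : Set X} (hK : Convex ℝ K)
    {φ : X → X → ℝ} (hcont : ∀ y ∈ K, Continuous fun x => φ x y)
    (hconc : ∀ x ∈ K, ConcaveOn ℝ K (φ x)) (hdiag : ∀ x ∈ K, φ x x ≤ 0)
    {ι : Type*} [Fintype ι] [Nonempty ι] (y : ι → X) (hy : ∀ j, y j ∈ K) :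
    ∃ x ∈ K, ∀ j, φ x (y j) ≤ 0 := by
  let b : (ι → ℝ) → X := fun t => ∑ j, t j • y j
  let gain : (ι → ℝ) → ι → ℝ := fun t j => max 0 (φ (b t) (y j))
  have hb : Continuous b := by fun_prop
  have hgain : ∀ j, Continuous fun t => gain t j := fun j =>
    continuous_const.max ((hcont _ (hy j)).comp hb)
  have hgain0 : ∀ t j, 0 ≤ gain t j := fun t j => le_max_left _ _
  have hpos : ∀ t, 0 < 1 + ∑ j, gain t j := fun t => by
    have := Finset.sum_nonneg fun j (_ : j ∈ Finset.univ) => hgain0 t j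
    linarith
  obtain ⟨t, ht, hfix⟩ := exists_fixedPoint_of_mapsTo_stdSimplex
    (f := fun t j => (t j + gain t j) / (1 + ∑ j, gain t j))
    (Continuous.continuousOn <| continuous_pi fun j =>
      ((continuous_apply j).add (hgain j)).div
        (continuous_const.add (continuous_finsetSum _ fun j _ => hgain j)) fun t => (hpos t).ne')
    (fun t ht => ⟨fun j => div_nonneg (add_nonneg (ht.1 j) (hgain0 t j)) (hpos t).le, by
      rw [← Finset.sum_div, Finset.sum_add_distrib, ht.2, div_self (hpos t).ne']⟩)
  have hbK : b t ∈ K := hK.sum_mem (fun j _ => ht.1 j) ht.2 fun j _ => hy j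
  set P := ∑ j, gain t j with hP
  have hfix' : ∀ j, gain t j = t j * P := fun j => by
    have h := congrFun hfix j
    rw [div_eq_iff (hpos t).ne'] at h
    linarith
  refine ⟨b t, hbK, fun j => ?_⟩
  suffices hP0 : P = 0 by
    have h := hfix' j
    rw [hP0, mul_zero] at h
    exact h ▸ le_max_right _ _
  by_contra hne
  have hPpos : 0 < P := lt_of_le_of_ne (Finset.sum_nonneg fun j _ => hgain0 t j) (Ne.symm hne)
  -- Every point that carries weight would be a strict gain, against concavity.
  have hterm : ∀ j, t j * φ (b t) (y j) = t j * (t j * P) := fun j => by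
    rcases (ht.1 j).eq_or_lt with h | h
    · rw [← h]; simp
    · have h1 : 0 < gain t j := hfix' j ▸ mul_pos h hPpos
      have h2 : gain t j = φ (b t) (y j) :=
        max_eq_right (le_of_lt ((lt_max_iff.1 h1).resolve_left (lt_irrefl _)))
      rw [← h2, hfix' j]
  have hjensen := (hconc _ hbK).le_map_sum (t := Finset.univ) (w := t) (p := y)
    (fun j _ => ht.1 j) ht.2 fun j _ => hy j
  simp only [smul_eq_mul, hterm] at hjensen
  have hsum : ∑ j, t j * (t j * P) ≤ 0 := hjensen.trans (hdiag _ hbK)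
  have hnn : ∀ j, 0 ≤ t j * (t j * P) := fun j =>
    mul_nonneg (ht.1 j) (mul_nonneg (ht.1 j) hPpos.le)
  have hall := (Finset.sum_eq_zero_iff_of_nonneg fun j _ => hnn j).1
    (le_antisymm hsum (Finset.sum_nonneg fun j _ => hnn j))
  have hzero : ∀ j, t j = 0 := fun j => by
    have h := hall j (Finset.mem_univ j)
    rcases mul_eq_zero.1 h with h | h
    · exact h
    · exact (mul_eq_zero.1 h).resolve_right hne
  have := ht.2
  simp [hzero] at this

/-- **Ky Fan's inequality** on a compact convex set: the finite case and the finite intersection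
property of the closed sets `{x | φ x y ≤ 0}`. -/
theorem exists_forall_nonpos_of_concaveOn {K : Set X} (hK : Convex ℝ K) (hKc : IsCompact K)
    (hne : K.Nonempty) {φ : X → X → ℝ} (hcont : ∀ y ∈ K, Continuous fun x => φ x y)
    (hconc : ∀ x ∈ K, ConcaveOn ℝ K (φ x)) (hdiag : ∀ x ∈ K, φ x x ≤ 0) :
    ∃ x ∈ K, ∀ y ∈ K, φ x y ≤ 0 := by
  obtain ⟨x, hxK, hx⟩ := hKc.inter_iInter_nonempty (fun y : K => {x | φ x y ≤ 0})
    (fun y => isClosed_le (hcont y y.2) continuous_const) fun u => by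
      rcases u.eq_empty_or_nonempty with rfl | hu
      · simpa using hne
      · have : Nonempty u := hu.to_subtype
        obtain ⟨x, hx, h⟩ := exists_forall_nonpos_of_finite hK hcont hconc hdiag
          (fun j : u => (j.1 : X)) fun j => j.1.2
        exact ⟨x, hx, Set.mem_iInter₂.2 fun y hy => h ⟨y, hy⟩⟩
  exact ⟨x, hxK, fun y hy => Set.mem_iInter.1 hx ⟨y, hy⟩⟩

end KyFan

/-- **Nikaido–Isoda theorem**: a game with compact convex strategy sets and continuous payoffs
that are concave in the player's own strategy has a pure Nash equilibrium. It is a point at which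
the total gain of simultaneous unilateral deviations obeys Ky Fan's inequality. -/
theorem exists_nash_of_concaveOn {ι : Type*} [Fintype ι] [DecidableEq ι] {X : ι → Type*}
    [∀ i, AddCommGroup (X i)] [∀ i, Module ℝ (X i)] [∀ i, TopologicalSpace (X i)]
    [∀ i, IsTopologicalAddGroup (X i)] [∀ i, ContinuousSMul ℝ (X i)]
    {K : ∀ i, Set (X i)} (hconv : ∀ i, Convex ℝ (K i)) (hcomp : ∀ i, IsCompact (K i))
    (hne : ∀ i, (K i).Nonempty) (u : ι → (∀ i, X i) → ℝ) (hcont : ∀ i, Continuous (u i))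
    (hconc : ∀ h : ∀ i, X i, (∀ i, h i ∈ K i) →
      ∀ i, ConcaveOn ℝ (K i) fun x => u i (Function.update h i x)) :
    ∃ h : ∀ i, X i, (∀ i, h i ∈ K i) ∧
      ∀ i, ∀ x ∈ K i, u i (Function.update h i x) ≤ u i h := by
  obtain ⟨h, hh, hle⟩ := exists_forall_nonpos_of_concaveOn (K := Set.univ.pi K)
    (convex_pi fun i _ => hconv i) (isCompact_univ_pi hcomp) (Set.univ_pi_nonempty_iff.2 hne)
    (φ := fun h h' => ∑ i, (u i (Function.update h i (h' i)) - u i h))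
    (fun y _ => continuous_finsetSum _ fun i _ =>
      ((hcont i).comp (continuous_id.update i continuous_const)).sub (hcont i))
    (fun h hh => by
      refine ⟨convex_pi fun i _ => hconv i, fun x hx y hy a b ha hb hab => ?_⟩
      simp only [smul_eq_mul, Finset.mul_sum, ← Finset.sum_add_distrib]
      refine Finset.sum_le_sum fun i _ => ?_
      have := (hconc h (fun i => hh i trivial) i).2 (hx i trivial) (hy i trivial) ha hb hab
      simp only [smul_eq_mul] at this
      simp only [Pi.add_apply, Pi.smul_apply]
      have h1 : u i h = a * u i h + b * u i h := by rw [← add_mul, hab, one_mul]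
      linarith)
    (fun h _ => by simp)
  refine ⟨h, fun i => hh i trivial, fun i x hx => ?_⟩
  -- A unilateral deviation changes only one summand.
  have := hle (Function.update h i x) fun j _ => by
    by_cases hj : j = i
    · subst hj; simpa using hx
    · simpa [hj] using hh j trivial
  rw [Finset.sum_eq_single_of_mem i (Finset.mem_univ i) fun j _ hj => by simp [hj]] at this
  simpa using this

/-! ### Concavity of the logistic function -/

/-- The logistic function is concave on the nonnegative reals: its derivative `σ (1 - σ)`
decreases once `σ ≥ 1 / 2`. -/
theorem Real.concaveOn_sigmoid : ConcaveOn ℝ (Set.Ici 0) Real.sigmoid := by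
  refine AntitoneOn.concaveOn_of_deriv (convex_Ici 0) continuous_sigmoid.continuousOn
    differentiable_sigmoid.differentiableOn ?_
  rw [interior_Ici, Real.deriv_sigmoid]
  intro x hx y hy hxy
  have h0 : (2⁻¹ : ℝ) ≤ Real.sigmoid x := by
    rw [← Real.sigmoid_zero]
    exact Real.sigmoid_monotone (le_of_lt hx)
  have h1 := Real.sigmoid_monotone hxy
  norm_num at h0
  nlinarith

/-! ### The feasible sets -/

namespace NetworkDesignGame

variable {N : ℕ} {V M : Type*} (G : NetworkDesignGame N V M)

theorem convex_feasible (i : Fin N) : Convex ℝ (G.feasible i) := by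
  intro x hx y hy a b ha hb hab
  refine ⟨fun e => ?_, ?_⟩
  · obtain ⟨⟨h1, h2⟩, ⟨h3, h4⟩, ⟨h5, h6⟩, h7, h8⟩ := hx.1 e
    obtain ⟨⟨k1, k2⟩, ⟨k3, k4⟩, ⟨k5, k6⟩, k7, k8⟩ := hy.1 e
    have hb' : b = 1 - a := by linarith
    subst hb'
    simp only [Pi.add_apply, Pi.smul_apply, Prod.fst_add, Prod.snd_add, Prod.smul_fst,
      Prod.smul_snd, smul_eq_mul, Set.mem_Icc]
    refine ⟨⟨?_, ?_⟩, ⟨?_, ?_⟩, ⟨?_, ?_⟩, ?_, ?_⟩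
    · linarith [mul_le_mul_of_nonneg_left h1 ha, mul_le_mul_of_nonneg_left k1 hb]
    · linarith [mul_le_mul_of_nonneg_left h2 ha, mul_le_mul_of_nonneg_left k2 hb]
    · linarith [mul_le_mul_of_nonneg_left h3 ha, mul_le_mul_of_nonneg_left k3 hb]
    · linarith [mul_le_mul_of_nonneg_left h4 ha, mul_le_mul_of_nonneg_left k4 hb]
    · linarith [mul_le_mul_of_nonneg_left h5 ha, mul_le_mul_of_nonneg_left k5 hb]
    · linarith [mul_le_mul_of_nonneg_left h6 ha, mul_le_mul_of_nonneg_left k6 hb]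
    · linarith [mul_le_mul_of_nonneg_left h7 ha, mul_le_mul_of_nonneg_left k7 hb]
    · linarith [mul_le_mul_of_nonneg_left h8 ha, mul_le_mul_of_nonneg_left k8 hb]
  · have h1 := mul_le_mul_of_nonneg_left hx.2 ha
    have h2 := mul_le_mul_of_nonneg_left hy.2 hb
    calc _ = a * ∑ e : {e // e ∈ G.Γ.regionPT i}, (G.costBase * G.Γ.length e.1 * (x e).1 +
            G.costFreq * G.Γ.length e.1 * (x e).2) +
          b * ∑ e : {e // e ∈ G.Γ.regionPT i}, (G.costBase * G.Γ.length e.1 * (y e).1 +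
            G.costFreq * G.Γ.length e.1 * (y e).2) := by
          rw [Finset.mul_sum, Finset.mul_sum, ← Finset.sum_add_distrib]
          refine Finset.sum_congr rfl fun e _ => ?_
          simp only [Pi.add_apply, Pi.smul_apply, Prod.fst_add, Prod.snd_add, Prod.smul_fst,
            Prod.smul_snd, smul_eq_mul]
          ring
      _ ≤ a * ((1 - G.beta i) * G.budget i) + b * ((1 - G.beta i) * G.budget i) :=
          add_le_add h1 h2
      _ = (1 - G.beta i) * G.budget i := by rw [← add_mul, hab, one_mul]

theorem isCompact_feasible (i : Fin N) : IsCompact (G.feasible i) := by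
  have hbox : IsCompact (Set.univ.pi fun _ : {e // e ∈ G.Γ.regionPT i} =>
      Set.Icc (0 : ℝ) 1 ×ˢ Set.Icc (0 : ℝ) G.smax) :=
    isCompact_univ_pi fun _ => isCompact_Icc.prod isCompact_Icc
  refine hbox.of_isClosed_subset ?_ fun x hx e _ => ⟨(hx.1 e).1, (hx.1 e).2.1⟩
  simp only [feasible, Set.mem_Icc, Set.ofPred_and, Set.ofPred_forall]
  refine IsClosed.inter (isClosed_iInter fun e => ?_) (isClosed_le (by fun_prop) (by fun_prop))
  exact ((isClosed_le (by fun_prop) (by fun_prop)).inter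
    (isClosed_le (by fun_prop) (by fun_prop))).inter <|
    ((isClosed_le (by fun_prop) (by fun_prop)).inter
    (isClosed_le (by fun_prop) (by fun_prop))).inter <|
    ((isClosed_le (by fun_prop) (by fun_prop)).inter
    (isClosed_le (by fun_prop) (by fun_prop))).inter <|
    (isClosed_le (by fun_prop) (by fun_prop)).inter (isClosed_le (by fun_prop) (by fun_prop))

theorem feasible_update {h : G.Profile} (hh : ∀ i, h i ∈ G.feasible i) {i : Fin N}
    {x : G.Strategy i} (hx : x ∈ G.feasible i) (j : Fin N) :
    Function.update h i x j ∈ G.feasible j := by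
  by_cases hj : j = i
  · subst hj
    simpa using hx
  · simpa [hj] using hh j

/-! ### Public transport flows are concave in an operator's own strategy -/

section Flow

variable [DecidableEq V]

theorem continuous_decision (e : V × V) : Continuous fun h : G.Profile => G.decision h e := by
  unfold decision
  split_ifs <;> fun_prop

theorem decision_snd_nonneg {h : G.Profile} (hh : ∀ i, h i ∈ G.feasible i) (e : V × V) :
    0 ≤ (G.decision h e).2 := by
  unfold decision
  split_ifs with he
  · exact ((hh _).1 ⟨e, he⟩).2.1.1
  · exact le_rfl

theorem decision_update_combination (h : G.Profile) (i : Fin N) (x y : G.Strategy i) {a b : ℝ}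
    (hab : a + b = 1) (e : V × V) :
    G.decision (Function.update h i (a • x + b • y)) e =
      a • G.decision (Function.update h i x) e + b • G.decision (Function.update h i y) e := by
  unfold decision
  split_ifs with he
  · by_cases hi : G.Γ.region e.1 = i
    · subst hi
      simp
    · simp only [Function.update_of_ne hi]
      rw [← add_smul, hab, one_smul]
  · simp

theorem continuous_ptUtility (m : M) : Continuous fun h : G.Profile => G.ptUtility h m := by
  have := fun e => (G.continuous_decision e).fst
  unfold ptUtility availability
  fun_prop

theorem ptUtility_update_combination (h : G.Profile) (i : Fin N) (x y : G.Strategy i) {a b : ℝ}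
    (hab : a + b = 1) (m : M) :
    G.ptUtility (Function.update h i (a • x + b • y)) m =
      a * G.ptUtility (Function.update h i x) m + b * G.ptUtility (Function.update h i y) m := by
  unfold ptUtility availability
  rw [mul_neg, mul_neg, ← neg_add, Finset.mul_sum, Finset.mul_sum, ← Finset.sum_add_distrib]
  congr 1
  refine Finset.sum_congr rfl fun e _ => ?_
  rw [G.decision_update_combination h i x y hab e, Prod.fst_add, Prod.smul_fst, Prod.smul_fst,
    smul_eq_mul, smul_eq_mul]
  have hb : b = 1 - a := by linarith
  subst hb
  ring

theorem ptShare_eq_sigmoid (h : G.Profile) (m : M) :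
    G.ptShare h m = Real.sigmoid (G.ptUtility h m - G.altUtility m) := by
  rw [ptShare, Real.sigmoid_def, neg_sub, Real.exp_sub]
  have h1 := Real.exp_pos (G.ptUtility h m)
  have h2 := Real.exp_pos (G.altUtility m)
  field_simp
  ring

theorem concaveOn_ptShare
    (hutility : ∀ h : G.Profile, (∀ i, h i ∈ G.feasible i) → ∀ m, G.altUtility m ≤ G.ptUtility h m)
    {h : G.Profile} (hh : ∀ i, h i ∈ G.feasible i) (i : Fin N) (m : M) :
    ConcaveOn ℝ (G.feasible i) fun x => G.ptShare (Function.update h i x) m := by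
  refine ⟨G.convex_feasible i, fun x hx y hy a b ha hb hab => ?_⟩
  simp only [ptShare_eq_sigmoid]
  have h1 := Real.concaveOn_sigmoid.2
    (sub_nonneg.2 (hutility _ (G.feasible_update hh hx) m) :
      G.ptUtility (Function.update h i x) m - G.altUtility m ∈ Set.Ici (0 : ℝ))
    (sub_nonneg.2 (hutility _ (G.feasible_update hh hy) m) :
      G.ptUtility (Function.update h i y) m - G.altUtility m ∈ Set.Ici (0 : ℝ)) ha hb hab
  convert h1 using 2
  rw [G.ptUtility_update_combination h i x y hab m, smul_eq_mul, smul_eq_mul]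
  have hb : b = 1 - a := by linarith
  subst hb
  ring

theorem ptShare_nonneg (h : G.Profile) (m : M) : 0 ≤ G.ptShare h m := by
  rw [ptShare_eq_sigmoid]
  exact Real.sigmoid_nonneg _

theorem continuous_ptShare (m : M) : Continuous fun h : G.Profile => G.ptShare h m := by
  simp only [ptShare_eq_sigmoid]
  exact continuous_sigmoid.comp ((G.continuous_ptUtility m).sub continuous_const)

variable [Fintype M]

/-- The number of trips that want to use the edge `e` by public transport, before capping at
capacity. -/
noncomputable def ptDemand (h : G.Profile) (e : V × V) : ℝ :=
  ∑ m, if e ∈ (G.request m).ptRoute then ((G.request m).trips : ℝ) * G.ptShare h m else 0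

theorem ptDemand_nonneg (h : G.Profile) (e : V × V) : 0 ≤ G.ptDemand h e :=
  Finset.sum_nonneg fun m _ => by
    split_ifs
    · exact mul_nonneg (Nat.cast_nonneg _) (G.ptShare_nonneg h m)
    · exact le_rfl

theorem continuous_ptDemand (e : V × V) : Continuous fun h : G.Profile => G.ptDemand h e := by
  unfold ptDemand
  refine continuous_finsetSum _ fun m _ => ?_
  split_ifs
  · exact continuous_const.mul (G.continuous_ptShare m)
  · exact continuous_const

theorem concaveOn_ptDemand
    (hutility : ∀ h : G.Profile, (∀ i, h i ∈ G.feasible i) → ∀ m, G.altUtility m ≤ G.ptUtility h m)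
    {h : G.Profile} (hh : ∀ i, h i ∈ G.feasible i) (i : Fin N) (e : V × V) :
    ConcaveOn ℝ (G.feasible i) fun x => G.ptDemand (Function.update h i x) e := by
  refine ⟨G.convex_feasible i, fun x hx y hy a b ha hb hab => ?_⟩
  simp only [ptDemand, smul_eq_mul, Finset.mul_sum, ← Finset.sum_add_distrib]
  refine Finset.sum_le_sum fun m _ => ?_
  split_ifs
  · have h1 := (G.concaveOn_ptShare hutility hh i m).2 hx hy ha hb hab
    have h2 := mul_le_mul_of_nonneg_left h1 (Nat.cast_nonneg (α := ℝ) (G.request m).trips)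
    simp only [smul_eq_mul] at h2
    linarith
  · simp

/-- The served flow in terms of real numbers. The truncation at `0` comes from `ENNReal.ofReal`
and is inactive for feasible profiles. -/
theorem ptFlow_eq (h : G.Profile) (e : V × V) :
    G.ptFlow h e = if G.Γ.chat e = ⊤ then G.ptDemand h e else
      min (G.ptDemand h e) ((G.Γ.chat e).toReal + max (G.kappa * (G.decision h e).2) 0) := by
  have hD := G.ptDemand_nonneg h e
  change (min (ENNReal.ofReal (G.ptDemand h e)) (G.capacity h e)).toReal = _
  rw [capacity]
  split_ifs with hc
  · rw [hc, top_add, min_eq_left le_top, ENNReal.toReal_ofReal hD]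
  · rw [ENNReal.toReal_min ENNReal.ofReal_ne_top (by simp [hc]), ENNReal.toReal_ofReal hD,
      ENNReal.toReal_add hc ENNReal.ofReal_ne_top, ENNReal.toReal_ofReal']

theorem continuous_ptFlow (e : V × V) : Continuous fun h : G.Profile => G.ptFlow h e := by
  simp only [ptFlow_eq]
  have h1 := G.continuous_ptDemand e
  have h2 := (G.continuous_decision e).snd
  split_ifs
  · exact h1
  · fun_prop

theorem concaveOn_ptFlow
    (hutility : ∀ h : G.Profile, (∀ i, h i ∈ G.feasible i) → ∀ m, G.altUtility m ≤ G.ptUtility h m)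
    {h : G.Profile} (hh : ∀ i, h i ∈ G.feasible i) (i : Fin N) (e : V × V) :
    ConcaveOn ℝ (G.feasible i) fun x => G.ptFlow (Function.update h i x) e := by
  have hD := G.concaveOn_ptDemand hutility hh i e
  by_cases hc : G.Γ.chat e = ⊤
  · simpa only [ptFlow_eq, if_pos hc] using hD
  · simp only [ptFlow_eq, if_neg hc]
    refine hD.inf ⟨G.convex_feasible i, fun x hx y hy a b ha hb hab => ?_⟩
    have hnn : ∀ z ∈ G.feasible i, 0 ≤ G.kappa * (G.decision (Function.update h i z) e).2 :=
      fun z hz => mul_nonneg G.kappa_nonneg (G.decision_snd_nonneg (G.feasible_update hh hz) e)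
    simp only
    rw [max_eq_left (hnn x hx), max_eq_left (hnn y hy),
      max_eq_left (hnn _ (G.convex_feasible i hx hy ha hb hab)),
      G.decision_update_combination h i x y hab e]
    have hb : b = 1 - a := by linarith
    subst hb
    simp only [Prod.snd_add, Prod.smul_snd, smul_eq_mul]
    exact le_of_eq (by ring)

/-- An edge on no public transport route carries no flow. Such an edge is harmless even if its
coefficient in the payoff is negative. -/
theorem ptFlow_eq_zero_of_forall_notMem {e : V × V} (he : ∀ m, e ∉ (G.request m).ptRoute)
    (h : G.Profile) : G.ptFlow h e = 0 := by
  simp [ptFlow, he]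

end Flow

/-! ### Payoffs as combinations of public transport flows -/

/-- The burden on operator `i` of one unit of flow on the alternative-mode edge `a` of its region.
-/
noncomputable def altWeight (i : Fin N) (a : V × V) : ℝ :=
  G.Γ.length a * (G.wE i * G.emissionA + G.wC i * (G.vot / G.speedA + G.priceA))

/-- The direct payoff to operator `i` of one unit of flow on the public transport edge `e` of its
region, without the relief of the substitutes of `e`. -/
noncomputable def ptWeight (i : Fin N) (e : V × V) : ℝ :=
  -G.Γ.length e * (G.wE i * G.emissionP + G.wC i * (G.vot / G.speedP + G.priceP)
      - G.wP i * G.priceP)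

/-- The cost of construction and frequency in the profit of operator `i`. -/
noncomputable def designCost (i : Fin N) (x : G.Strategy i) : ℝ :=
  ∑ e : {e // e ∈ G.Γ.regionPT i},
    (G.costBase * G.Γ.length e.1 * (G.Γ.xhat e.1 + (x e).1) +
      G.costFreq * G.Γ.length e.1 * (x e).2)

theorem altWeight_nonneg (i : Fin N) (a : V × V) : 0 ≤ G.altWeight i a := by
  have h1 := mul_nonneg (G.wE_nonneg i) G.emissionA_nonneg
  have h2 := mul_nonneg (G.wC_nonneg i)
    (add_nonneg (div_nonneg G.vot_nonneg G.speedA_pos.le) G.priceA_nonneg)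
  exact mul_nonneg (NNReal.coe_nonneg _) (add_nonneg h1 h2)

theorem notMem_ptEdges_of_mem_regionAlt {i : Fin N} {a : V × V} (ha : a ∈ G.Γ.regionAlt i) :
    a ∉ G.Γ.ptEdges := by
  intro h
  have h1 := (Finset.mem_filter.1 (Finset.mem_filter.1 ha).1).2.1
  have h2 := (Finset.mem_filter.1 h).2.1
  simp [h1] at h2

section Payoff

variable [DecidableEq V]

/-- The burden that one unit of flow on the public transport edge `e` takes off the substitutes of
`e` in region `i`, for one request that uses `e`. -/
noncomputable def substitutionGain (i : Fin N) (e : V × V) : ℝ :=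
  ∑ a ∈ G.Γ.regionAlt i, if a ∈ G.substitutes e then G.altWeight i a else 0

theorem substitutionGain_nonneg (i : Fin N) (e : V × V) : 0 ≤ G.substitutionGain i e :=
  Finset.sum_nonneg fun a _ => by
    split_ifs
    · exact G.altWeight_nonneg i a
    · exact le_rfl

theorem marginalPayoff_eq {i : Fin N} {e : V × V}
    (hsub : G.substitutes e ⊆ G.Γ.regionAlt i) :
    G.marginalPayoff i e = G.ptWeight i e + G.substitutionGain i e := by
  have : G.substitutionGain i e =
      ∑ a ∈ G.Γ.altEdges, if a ∈ G.substitutes e then G.altWeight i a else 0 := by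
    refine Finset.sum_subset (Finset.filter_subset _ _) fun a _ ha => ?_
    rw [if_neg fun h => ha (hsub h)]
  rw [this]
  rfl

variable [Fintype M]

/-- The coefficient of the flow on `e` in the payoff of operator `i`. In the flow on
alternative-mode edges every request through `e` subtracts the whole flow on `e`, so the
substitution gain counts once per such request. -/
noncomputable def flowCoefficient (i : Fin N) (e : V × V) : ℝ :=
  (if e ∈ G.Γ.regionPT i then G.ptWeight i e else 0) +
    ∑ m, if e ∈ (G.request m).ptRoute then G.substitutionGain i e else 0

/-- The part of the burden of alternative-mode flow in region `i` that does not depend on the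
strategies. -/
noncomputable def baselineBurden (i : Fin N) : ℝ :=
  ∑ a ∈ G.Γ.regionAlt i, G.altWeight i a *
    ∑ m, if a ∈ (G.request m).altRoute then ((G.request m).trips : ℝ) * G.phat a else 0

/-- On an edge that some request uses, the coefficient is at least `marginalPayoff` inside the
region, and a sum of nonnegative gains outside. -/
theorem flowCoefficient_nonneg {i : Fin N}
    (hsub : ∀ e ∈ G.Γ.regionPT i, G.substitutes e ⊆ G.Γ.regionAlt i)
    (hmarginal : ∀ e ∈ G.Γ.regionPT i, 0 ≤ G.marginalPayoff i e) {e : V × V} {m : M}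
    (he : e ∈ (G.request m).ptRoute) : 0 ≤ G.flowCoefficient i e := by
  have hnn : ∀ m, 0 ≤ if e ∈ (G.request m).ptRoute then G.substitutionGain i e else 0 := by
    intro m
    split_ifs
    · exact G.substitutionGain_nonneg i e
    · exact le_rfl
  have hle := Finset.single_le_sum (fun m _ => hnn m) (Finset.mem_univ m)
  simp only [if_pos he] at hle
  rw [flowCoefficient]
  split_ifs with hi
  · have h1 := hmarginal e hi
    rw [G.marginalPayoff_eq (hsub e hi)] at h1
    linarith
  · linarith [G.substitutionGain_nonneg i e]

/-- At induced flows, the payoff is a linear combination of public transport flows minus an affine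
function of the own strategy. -/
theorem payoff_demand_eq (i : Fin N) (x : G.Strategy i) (h : G.Profile) :
    G.payoff i x (G.demand h) = ∑ e ∈ G.Γ.ptEdges, G.flowCoefficient i e * G.ptFlow h e
      - G.wP i * G.designCost i x - G.baselineBurden i := by
  have hpay : G.payoff i x (G.demand h) =
      ∑ e ∈ G.Γ.regionPT i, G.ptWeight i e * G.demand h e
      - ∑ a ∈ G.Γ.regionAlt i, G.altWeight i a * G.demand h a - G.wP i * G.designCost i x := by
    have h1 : ∑ e ∈ G.Γ.regionPT i, G.ptWeight i e * G.demand h e =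
        -G.wE i * ∑ e ∈ G.Γ.regionPT i, G.emissionP * G.Γ.length e * G.demand h e
        - G.wC i * ∑ e ∈ G.Γ.regionPT i,
          G.Γ.length e * G.demand h e * (G.vot / G.speedP + G.priceP)
        + G.wP i * ∑ e ∈ G.Γ.regionPT i, G.priceP * G.Γ.length e * G.demand h e := by
      simp only [Finset.mul_sum]
      rw [← Finset.sum_sub_distrib, ← Finset.sum_add_distrib]
      refine Finset.sum_congr rfl fun e _ => ?_
      rw [ptWeight]
      ring
    have h2 : ∑ a ∈ G.Γ.regionAlt i, G.altWeight i a * G.demand h a =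
        G.wE i * ∑ a ∈ G.Γ.regionAlt i, G.emissionA * G.Γ.length a * G.demand h a
        + G.wC i * ∑ a ∈ G.Γ.regionAlt i,
          G.Γ.length a * G.demand h a * (G.vot / G.speedA + G.priceA) := by
      simp only [Finset.mul_sum]
      rw [← Finset.sum_add_distrib]
      refine Finset.sum_congr rfl fun e _ => ?_
      rw [altWeight]
      ring
    rw [h1, h2, payoff, emissions, travelCost, profit, designCost]
    ring
  have hpt : ∑ e ∈ G.Γ.regionPT i, G.ptWeight i e * G.demand h e =
      ∑ e ∈ G.Γ.ptEdges, (if e ∈ G.Γ.regionPT i then G.ptWeight i e else 0) * G.ptFlow h e := by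
    have hsub : G.Γ.regionPT i ⊆ G.Γ.ptEdges := Finset.filter_subset _ _
    rw [← Finset.sum_subset hsub fun e _ he => by rw [if_neg he, zero_mul]]
    refine Finset.sum_congr rfl fun e he => ?_
    rw [if_pos he, demand, if_pos (Finset.mem_filter.1 he).1]
  have halt : ∑ a ∈ G.Γ.regionAlt i, G.altWeight i a * G.demand h a = G.baselineBurden i -
      ∑ e ∈ G.Γ.ptEdges,
        (∑ m, if e ∈ (G.request m).ptRoute then G.substitutionGain i e else 0) *
          G.ptFlow h e := by
    have hroute : ∀ m (a : V × V), (∑ e ∈ (G.request m).ptRoute,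
        if a ∈ G.substitutes e then G.ptFlow h e else 0) = ∑ e ∈ G.Γ.ptEdges,
        if e ∈ (G.request m).ptRoute then (if a ∈ G.substitutes e then G.ptFlow h e else 0)
          else 0 := by
      intro m a
      rw [Finset.sum_ite_mem, Finset.inter_eq_right.2 (G.request m).ptRoute_subset]
    have hswap : ∑ a ∈ G.Γ.regionAlt i, G.altWeight i a * ∑ m, ∑ e ∈ (G.request m).ptRoute,
        (if a ∈ G.substitutes e then G.ptFlow h e else 0) = ∑ e ∈ G.Γ.ptEdges,
        (∑ m, if e ∈ (G.request m).ptRoute then G.substitutionGain i e else 0) *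
          G.ptFlow h e := by
      simp only [hroute, substitutionGain, Finset.mul_sum, Finset.sum_mul]
      rw [Finset.sum_comm]
      rw [Finset.sum_comm (s := G.Γ.ptEdges)]
      refine Finset.sum_congr rfl fun m _ => ?_
      rw [Finset.sum_comm]
      refine Finset.sum_congr rfl fun e _ => ?_
      split_ifs
      · rw [Finset.sum_mul]
        refine Finset.sum_congr rfl fun a _ => ?_
        split_ifs <;> ring
      · simp
    rw [← hswap, baselineBurden, ← Finset.sum_sub_distrib]
    refine Finset.sum_congr rfl fun a ha => ?_
    rw [demand, if_neg (G.notMem_ptEdges_of_mem_regionAlt ha), altFlow, Finset.sum_sub_distrib,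
      mul_sub]
  rw [hpay, hpt, halt]
  simp only [flowCoefficient, add_mul, Finset.sum_add_distrib]
  ring

theorem continuous_payoff (i : Fin N) :
    Continuous fun h : G.Profile => G.payoff i (h i) (G.demand h) := by
  have := G.continuous_ptFlow
  simp only [payoff_demand_eq, designCost]
  fun_prop

theorem concaveOn_payoff
    (hutility : ∀ h : G.Profile, (∀ i, h i ∈ G.feasible i) → ∀ m, G.altUtility m ≤ G.ptUtility h m)
    {i : Fin N} (hsub : ∀ e ∈ G.Γ.regionPT i, G.substitutes e ⊆ G.Γ.regionAlt i)
    (hmarginal : ∀ e ∈ G.Γ.regionPT i, 0 ≤ G.marginalPayoff i e)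
    {h : G.Profile} (hh : ∀ i, h i ∈ G.feasible i) :
    ConcaveOn ℝ (G.feasible i) fun x => G.payoff i x (G.demand (Function.update h i x)) := by
  refine ⟨G.convex_feasible i, fun x hx y hy a b ha hb hab => ?_⟩
  simp only [payoff_demand_eq, smul_eq_mul]
  have hflow : a * ∑ e ∈ G.Γ.ptEdges, G.flowCoefficient i e * G.ptFlow (Function.update h i x) e +
      b * ∑ e ∈ G.Γ.ptEdges, G.flowCoefficient i e * G.ptFlow (Function.update h i y) e ≤
      ∑ e ∈ G.Γ.ptEdges,
        G.flowCoefficient i e * G.ptFlow (Function.update h i (a • x + b • y)) e := by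
    rw [Finset.mul_sum, Finset.mul_sum, ← Finset.sum_add_distrib]
    refine Finset.sum_le_sum fun e _ => ?_
    by_cases he : ∀ m, e ∉ (G.request m).ptRoute
    · simp [G.ptFlow_eq_zero_of_forall_notMem he]
    · push Not at he
      obtain ⟨m, hm⟩ := he
      have h1 := mul_le_mul_of_nonneg_left
        ((G.concaveOn_ptFlow hutility hh i e).2 hx hy ha hb hab)
        (G.flowCoefficient_nonneg hsub hmarginal hm)
      simp only [smul_eq_mul] at h1
      linarith
  have hcost : G.designCost i (a • x + b • y) =
      a * G.designCost i x + b * G.designCost i y := by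
    simp only [designCost, Finset.mul_sum, ← Finset.sum_add_distrib]
    refine Finset.sum_congr rfl fun e _ => ?_
    simp only [Pi.add_apply, Pi.smul_apply, Prod.fst_add, Prod.snd_add, Prod.smul_fst,
      Prod.smul_snd, smul_eq_mul]
    have hb : b = 1 - a := by linarith
    subst hb
    ring
  have hbase : G.baselineBurden i = a * G.baselineBurden i + b * G.baselineBurden i := by
    rw [← add_mul, hab, one_mul]
  rw [hcost]
  linarith

end Payoff

end NetworkDesignGame

theorem mainTheorem1 {N : ℕ} {V M : Type*} [DecidableEq V] [Fintype M]
    (G : NetworkDesignGame N V M)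
    (hfeasible : ∀ i, (G.feasible i).Nonempty)
    (hsubstitutes : ∀ i, ∀ e ∈ G.Γ.regionPT i, G.substitutes e ⊆ G.Γ.regionAlt i)
    (hutility : ∀ h : G.Profile, (∀ i, h i ∈ G.feasible i) →
      ∀ m, G.altUtility m ≤ G.ptUtility h m)
    (hmarginal : ∀ i, ∀ e ∈ G.Γ.regionPT i, 0 ≤ G.marginalPayoff i e) :
    ∃ h : G.Profile, G.IsNashEquilibrium h := by
  obtain ⟨h, hh, hbest⟩ := exists_nash_of_concaveOn G.convex_feasible G.isCompact_feasible
    hfeasible (fun i h => G.payoff i (h i) (G.demand h)) G.continuous_payoff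
    fun h hh i => by
      simpa only [Function.update_self] using
        G.concaveOn_payoff hutility (hsubstitutes i) (hmarginal i) hh
  exact ⟨h, fun i => ⟨hh i, fun x hx => by simpa only [Function.update_self] using hbest i x hx⟩⟩
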